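/- Let $n\ge 1$ be an integer, $q=2^n$ and $d=q^3+q^2+q-1$, and let $F(x)=x^d$ on the finite field $\mathbb{F}_{q^4}$ with $q^4$ elements. Then $F$ is a permutation of $\mathbb{F}_{q^4}$. Moreover, for every $c\in\mathbb{F}_{q^4}$ with $c^{q^2+1}=1$ and $c\ne 1$, the function $F$ is almost perfect $c$-nonlinear (APcN), i.e. its $c$-differential uniformity equals $2$: $$\max_{a,b\in\mathbb{F}_{q^4}}\#\{x\in\mathbb{F}_{q^4} : (x+a)^d-c\,x^d=b\}=2 .$$ In other words, for all $a,b\in\mathbb{F}_{q^4}$ the equation $(x+a)^d-c\,x^d=b$ has at most two solutions $x\in\mathbb{F}_{q^4}$, and for some $a,b$ it has exactly two. -/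

import Mathlib

/-- The (multiplicative) `c`-derivative of `f` with respect to `a`. -/
def cDerivative {F : Type*} [Field F] (c : F) (f : F → F) (a : F) : F → F :=
  fun x => f (x + a) - c * f x

/-- The number of solutions `x` of `f (x + a) - c * f x = b`. -/
def cDifferentialCount {F : Type*} [Field F] [Fintype F] [DecidableEq F]
    (c : F) (f : F → F) (a b : F) : ℕ :=
  (Finset.univ.filter fun x : F => cDerivative c f a x = b).card

/-- The `c`-differential uniformity of `f`: the maximum over all `a, b` of the number of
solutions of `f (x + a) - c * f x = b`. (For `c = 1`, where the standard definition excludes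
`a = 0`, this is not the usual differential uniformity.) -/
def cDifferentialUniformity {F : Type*} [Field F] [Fintype F] [DecidableEq F]
    (c : F) (f : F → F) : ℕ :=
  Finset.univ.sup fun p : F × F => cDifferentialCount c f p.1 p.2

/-- `f` is almost perfect `c`-nonlinear: its `c`-differential uniformity is exactly `2`. -/
def IsAPcN {F : Type*} [Field F] [Fintype F] [DecidableEq F] (c : F) (f : F → F) : Prop :=
  cDifferentialUniformity c f = 2

/-- The set of all `s`-th roots of unity in `F`. -/
def mu (F : Type*) [Field F] (s : ℕ) : Set F :=
  {x | x ≠ 0 ∧ x ^ s = 1}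

/-!
Write `φ` for the `q`-power map, `L = 𝔽_{q²}` for the fixed field of `φ ∘ φ`, and `N` for the norm
`x ↦ x * φ (φ x)` to `L`. Since `x ^ d * x = φ x * φ (φ x) * φ (φ (φ x))`, one has
`x ^ d = r * φ (φ x) ^ 2` for `x ≠ 0`, where `r = N(x) ^ (q - 1)` is an element of `L` with
`r * φ r = 1`. By homogeneity only the equation
`(x + 1) ^ d + c * x ^ d = b` matters; with `p = N(x + 1) ^ (q - 1)` it becomes *linear* in
`φ (φ x) ^ 2`:
`φ (φ x) ^ 2 * (p + c * r) = b + p`.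
So the pair `(p, r)` determines `x`, and it remains to count pairs. Writing `b = e + f * c` with
`e`, `f` in `L` and taking norms gives two equations for `(p, r)` (`exists_solutionPair`).

If `p ≠ r`, put `u = p * r / (p + r) ^ 2`. It lies in `𝔽_q` and has absolute trace one
(`trace_ratioInvariant`). Eliminating `p` from the two equations leaves a quadratic equation for `u`
over `𝔽_q` (`SolutionPair.quadratic`). If it has two distinct roots, their sum is
`θ + φ θ + (y ^ 2 + y)` with `y` in `𝔽_q` and `θ = c / (1 + c) ^ 2`; this has trace one because `c`
generates `𝔽_{q⁴}` over `L` and is a root of `X ^ 2 + θ⁻¹ * X + 1`. So only one of the roots has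
trace one, and `u` is determined by `b` (`SolutionPair.ratioInvariant_eq`). Then `r / p` is
determined up to inversion, and `r / p` determines the pair (`SolutionPair.eq_of_ratio_eq`). Pairs
with `p = r` satisfy a quadratic equation themselves, and the same trace argument shows that they do
not coexist with pairs `p ≠ r` (`SolutionPair.not_diagonal_of_ne`). The values `b = 1` and `b = c`,
taken at `x = 0` and `x = 1`, are treated separately.

That two solutions do occur follows from the symmetry between `x ↦ φ (φ x) + 1` and
`b ↦ c * φ (φ b)`: if `x ↦ (x + 1) ^ d + c * x ^ d` were bijective, it would match the fixed points
of these two involutions, and an explicit fixed value is missed (`not_injective`).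

The trace enters only through an additive map `Tr` with `Tr (y ^ 2 + y) = φ y + y`, namely
`z ↦ ∑ i < n, z ^ 2 ^ i`.
-/

/-! ### Pairs attached to solutions -/

/-- The binary form `θ * N (X + c * Y)`, where `N` is the norm from `𝔽_{q⁴}` to `𝔽_{q²}`, the element
`c ≠ 1` has norm one, and `θ = (c + c⁻¹)⁻¹`. -/
def scaledNorm {K : Type*} [Field K] (θ x y : K) : K := θ * (x + y) ^ 2 + x * y

/-- The conditions met by the pair `p = N(x + 1) ^ (q - 1)`, `r = N(x) ^ (q - 1)` attached to a
solution `x ≠ 0, 1` of `(x + 1) ^ d - c * x ^ d = e + f * c`, with `e`, `f` in `𝔽_{q²}`; here `N` is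
the norm to `𝔽_{q²}` and `φ` the `q`-power map. -/
structure SolutionPair {K : Type*} [Field K] (φ : K →+* K) (θ e f p r : K) : Prop where
  p_unit : p * φ p = 1
  r_unit : r * φ r = 1
  left : p ^ 2 * (scaledNorm (φ θ) (φ e) (φ f) * scaledNorm θ p r + θ * scaledNorm (φ θ) p r)
    + p * (φ f * scaledNorm θ p r + f * scaledNorm (φ θ) p r)
    + (φ θ * scaledNorm θ p r + scaledNorm θ e f * scaledNorm (φ θ) p r) = 0
  right : r ^ 2 * (scaledNorm (φ θ) (φ e) (φ f) * scaledNorm θ p r + θ * scaledNorm (φ θ) p r)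
    + r * (φ e * scaledNorm θ p r + e * scaledNorm (φ θ) p r)
    + (φ θ * scaledNorm θ p r + scaledNorm θ e f * scaledNorm (φ θ) p r) = 0
  ne : scaledNorm θ p r ≠ 0
  ne' : scaledNorm (φ θ) p r ≠ 0

section Pairs

variable {K : Type*} [Field K] {φ : K →+* K} {θ e f p r p₁ r₁ p₂ r₂ p₃ r₃ : K}

theorem map_scaledNorm : φ (scaledNorm θ e f) = scaledNorm (φ θ) (φ e) (φ f) := by
  simp [scaledNorm]

theorem map_add_map {x : K} (hx : φ (φ x) = x) : φ (x + φ x) = x + φ x := by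
  rw [map_add, hx, add_comm]

namespace SolutionPair

theorem p_ne (h : SolutionPair φ θ e f p r) : p ≠ 0 := left_ne_zero_of_mul_eq_one h.p_unit
theorem r_ne (h : SolutionPair φ θ e f p r) : r ≠ 0 := left_ne_zero_of_mul_eq_one h.r_unit

end SolutionPair

variable [CharP K 2]

theorem add_ne_zero_of_ne {x y : K} (h : x ≠ y) : x + y ≠ 0 := fun h0 =>
  h (CharTwo.add_eq_zero.1 h0)

/-! ### The quadratic equation for the ratio -/

/-- The element `(ρ + ρ⁻¹)⁻¹` with `ρ = r / p`, in terms of which the conditions on a solution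
pair become a quadratic equation over `𝔽_q`. -/
def ratioInvariant {K : Type*} [Field K] (p r : K) : K := p * r / (p + r) ^ 2

theorem ratioInvariant_mul (h : p ≠ r) : ratioInvariant p r * (p + r) ^ 2 = p * r := by
  have a := add_ne_zero_of_ne h
  unfold ratioInvariant
  field_simp

theorem ratio_eq_or_of_ratioInvariant_eq (h₁ : p₁ ≠ r₁) (h₂ : p₂ ≠ r₂)
    (h : ratioInvariant p₁ r₁ = ratioInvariant p₂ r₂) :
    r₁ * p₂ = p₁ * r₂ ∨ r₁ * r₂ = p₁ * p₂ := by
  have a₁ := ratioInvariant_mul h₁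
  have a₂ := ratioInvariant_mul h₂
  rw [h] at a₁
  have : (r₁ * p₂ + p₁ * r₂) * (r₁ * r₂ + p₁ * p₂) = 0 := by
    linear_combination (norm := grind) -(p₂ + r₂) ^ 2 * a₁ + (p₁ + r₁) ^ 2 * a₂
  rcases mul_eq_zero.1 this with h | h
  · exact Or.inl (CharTwo.add_eq_zero.1 h)
  · exact Or.inr (CharTwo.add_eq_zero.1 h)

theorem map_ratioInvariant (hp : p * φ p = 1) (hr : r * φ r = 1) (h : p ≠ r) :
    φ (ratioInvariant p r) = ratioInvariant p r := by
  have a := add_ne_zero_of_ne h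
  have h1 := ratioInvariant_mul h
  have h2 := congrArg φ h1
  simp only [map_mul, map_pow, map_add] at h2
  have h3 : p * r * (φ p + φ r) = p + r := by linear_combination r * hp + p * hr
  refine mul_right_cancel₀ (pow_ne_zero 2 a) ?_
  rw [h1]
  calc φ (ratioInvariant p r) * (p + r) ^ 2
      = (p * r) ^ 2 * (φ (ratioInvariant p r) * (φ p + φ r) ^ 2) := by rw [← h3]; ring
    _ = p * r * ((p * φ p) * (r * φ r)) := by rw [h2]; ring
    _ = p * r := by rw [hp, hr]; ring

variable {Tr : K →+ K}

/-- `ratioInvariant p r = y ^ 2 + y` for `y = r / (p + r)`, and `φ y = y + 1`. -/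
theorem trace_ratioInvariant (hTr : ∀ y, Tr (y ^ 2 + y) = φ y + y) (hp : p * φ p = 1)
    (hr : r * φ r = 1) (h : p ≠ r) : Tr (ratioInvariant p r) = 1 := by
  have a := add_ne_zero_of_ne h
  have h3 : p * r * (φ p + φ r) = p + r := by linear_combination r * hp + p * hr
  have a' : φ p + φ r ≠ 0 := fun h0 => a (by rw [← h3, h0, mul_zero])
  have hu : ratioInvariant p r = (r / (p + r)) ^ 2 + r / (p + r) := by
    have : ratioInvariant p r = (r ^ 2 + r * (p + r)) / (p + r) ^ 2 := by
      unfold ratioInvariant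
      congr 1
      clear * -
      grind
    rw [this]
    field_simp
  rw [hu, hTr, map_div₀, map_add]
  have : φ r / (φ p + φ r) = p / (p + r) := by
    rw [div_eq_div_iff a' a]
    linear_combination hr - hp
  rw [this, ← add_div, div_self a]

/-- The pair equations after division by `(p + r) ^ 2`, with `v = θ + u` and `v' = φ θ + u`. -/
theorem SolutionPair.reduced (h : SolutionPair φ θ e f p r) (hne : p ≠ r) {v v' : K}
    (hv : v = θ + ratioInvariant p r) (hv' : v' = φ θ + ratioInvariant p r) :
    p ^ 2 * (scaledNorm (φ θ) (φ e) (φ f) * v + θ * v') + p * (φ f * v + f * v')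
        + (φ θ * v + scaledNorm θ e f * v') = 0 ∧
      r ^ 2 * (scaledNorm (φ θ) (φ e) (φ f) * v + θ * v') + r * (φ e * v + e * v')
        + (φ θ * v + scaledNorm θ e f * v') = 0 ∧ v ≠ 0 ∧ v' ≠ 0 := by
  have a := pow_ne_zero 2 (add_ne_zero_of_ne hne)
  have e1 : scaledNorm θ p r = (p + r) ^ 2 * v := by
    rw [hv, scaledNorm, ← ratioInvariant_mul hne]; ring
  have e2 : scaledNorm (φ θ) p r = (p + r) ^ 2 * v' := by
    rw [hv', scaledNorm, ← ratioInvariant_mul hne]; ring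
  have l := h.left
  have r' := h.right
  have n := h.ne
  have n' := h.ne'
  rw [e1] at l r' n
  rw [e2] at l r' n'
  refine ⟨mul_left_cancel₀ a ?_, mul_left_cancel₀ a ?_, right_ne_zero_of_mul n,
    right_ne_zero_of_mul n'⟩
  · linear_combination l
  · linear_combination r'

/-- The identity in characteristic two behind the quadratic equation for `ratioInvariant p r`. -/
theorem quadratic_identity (u e e' f f' θ θ' : K) :
    u ^ 2 * ((f' * (θ + u) + f * (θ' + u)) + (e' * (θ + u) + e * (θ' + u))) ^ 2
      + u * (f' * (θ + u) + f * (θ' + u)) * (e' * (θ + u) + e * (θ' + u))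
      + (scaledNorm θ' e' f' * (θ + u) + θ * (θ' + u))
        * (θ' * (θ + u) + scaledNorm θ e f * (θ' + u))
    = (θ + u) * (θ' + u) * ((e + e' + f + f') ^ 2 * u ^ 2
      + ((e + e') * (f + f') + (θ + θ') * (e + e' + f + f') ^ 2) * u
      + (θ + scaledNorm θ e f) * (θ' + scaledNorm θ' e' f')) := by
  unfold scaledNorm
  grind

/-- The resultant of two quadratic equations with the same outer coefficients, one for `p` and one
for `r`. -/
theorem eliminate_pair {S T V V' u : K} (hne : p ≠ r) (hu : u * (p + r) ^ 2 = p * r)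
    (h₁ : p ^ 2 * V + p * S + V' = 0) (h₂ : r ^ 2 * V + r * T + V' = 0) :
    u ^ 2 * (S + T) ^ 2 + u * S * T + V * V' = 0 := by
  have a := add_ne_zero_of_ne hne
  have a₁ : (p + r) ^ 2 * V = p * S + r * T := by
    linear_combination (norm := grind) h₁ + h₂
  have a₂ : (p + r) ^ 2 * V' = p * r * (r * S + p * T) := by
    linear_combination (norm := grind) r ^ 2 * h₁ + p ^ 2 * h₂
  refine mul_left_cancel₀ (pow_ne_zero 4 a) ?_
  have a₃ : (p + r) ^ 4 * (V * V') = (p * S + r * T) * (p * r * (r * S + p * T)) := by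
    rw [← a₁, ← a₂]; ring
  have a₄ : (p + r) ^ 4 * (u ^ 2 * (S + T) ^ 2 + u * S * T)
      = (p * r) ^ 2 * (S + T) ^ 2 + p * r * (p + r) ^ 2 * S * T := by
    rw [← hu]; ring
  linear_combination (norm := grind) a₃ + a₄

/-- The quadratic equation over `𝔽_q` for `ratioInvariant p r`, whose coefficients depend only on
`c` and on the value `e + f * c`. -/
theorem SolutionPair.quadratic (h : SolutionPair φ θ e f p r) (hne : p ≠ r) :
    (e + φ e + f + φ f) ^ 2 * ratioInvariant p r ^ 2
      + ((e + φ e) * (f + φ f) + (θ + φ θ) * (e + φ e + f + φ f) ^ 2) * ratioInvariant p r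
      + (θ + scaledNorm θ e f) * (φ θ + scaledNorm (φ θ) (φ e) (φ f)) = 0 := by
  obtain ⟨h₁, h₂, n, n'⟩ := h.reduced hne rfl rfl
  have := eliminate_pair hne (ratioInvariant_mul hne) h₁ h₂
  rw [quadratic_identity] at this
  exact (mul_eq_zero.1 this).resolve_left (mul_ne_zero n n')

/-! ### Trace obstructions and the count of pairs -/

section Trace

variable (hTr : ∀ y, Tr (y ^ 2 + y) = φ y + y) (hθ : Tr (θ + φ θ) = 1)
include hTr

theorem trace_eq_zero_of_map_eq {y : K} (hy : φ y = y) : Tr (y ^ 2 + y) = 0 := by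
  rw [hTr, hy, CharTwo.add_self_eq_zero]

include hθ

theorem add_map_ne {y : K} (hy : φ y = y) : θ + φ θ ≠ y ^ 2 + y := fun h => by
  rw [h, trace_eq_zero_of_map_eq hTr hy] at hθ
  exact zero_ne_one hθ

theorem add_map_ne_zero : θ + φ θ ≠ 0 := by
  simpa using add_map_ne hTr hθ (map_zero φ)

variable (hθθ : φ (φ θ) = θ)
include hθθ

/-- The coefficients of the pair equations do not vanish together: otherwise `θ + φ θ` would have
the form `y ^ 2 + y` with `y` in `𝔽_q`, against `Tr (θ + φ θ) = 1`. -/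
theorem coefficients_not_all_zero {u : K} (hu : φ u = u) (hv : θ + u ≠ 0)
    (hS : φ f * (θ + u) + f * (φ θ + u) = 0) (hT : φ e * (θ + u) + e * (φ θ + u) = 0) :
    φ θ * (θ + u) + scaledNorm θ e f * (φ θ + u) ≠ 0 := fun hV => by
  have hv' : φ θ + u ≠ 0 := by
    rw [← hu, ← map_add]; exact (map_ne_zero φ).2 hv
  obtain ⟨x, hx⟩ : ∃ x, x = e * (φ θ + u) := ⟨_, rfl⟩
  obtain ⟨y, hy⟩ : ∃ y, y = f * (φ θ + u) := ⟨_, rfl⟩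
  have hxx : φ x = x := by
    rw [hx, map_mul, map_add, hθθ, hu]; exact CharTwo.add_eq_zero.1 hT
  have hyy : φ y = y := by
    rw [hy, map_mul, map_add, hθθ, hu]; exact CharTwo.add_eq_zero.1 hS
  have k₁ : φ θ * ((θ + u) * (φ θ + u)) = θ * (x + y) ^ 2 + x * y := by
    refine CharTwo.add_eq_zero.1 ?_
    rw [hx, hy]
    unfold scaledNorm at hV
    linear_combination (φ θ + u) * hV
  have k₂ : θ * ((θ + u) * (φ θ + u)) = φ θ * (x + y) ^ 2 + x * y := by
    have := congrArg φ k₁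
    simp only [map_mul, map_add, map_pow, hxx, hyy, hθθ, hu] at this
    rw [← this]; ring
  have k₃ : (θ + u) * (φ θ + u) = (x + y) ^ 2 := by
    refine mul_left_cancel₀ (add_map_ne_zero hTr hθ) ?_
    linear_combination (norm := (clear * -; grind)) k₁ + k₂
  have hxy : x + y ≠ 0 := by
    intro h0
    rw [h0] at k₃
    exact mul_ne_zero hv hv' (by simpa using k₃)
  refine add_map_ne hTr hθ (y := x / (x + y)) (by rw [map_div₀, map_add, hxx, hyy]) ?_
  field_simp
  rw [k₃] at k₁
  linear_combination (norm := (clear * -; grind)) k₁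

variable (hee : φ (φ e) = e) (hff : φ (φ f) = f)
include hee hff

/-- The coefficient of `p ^ 2` in the reduced pair equations is nonzero; its image under `φ` is the
constant coefficient, so its vanishing would make all the coefficients vanish. -/
theorem SolutionPair.leading_ne (h : SolutionPair φ θ e f p r) (hne : p ≠ r) :
    scaledNorm (φ θ) (φ e) (φ f) * (θ + ratioInvariant p r)
      + θ * (φ θ + ratioInvariant p r) ≠ 0 := fun hV => by
  obtain ⟨h₁, h₂, n, n'⟩ := h.reduced hne rfl rfl
  have hu := map_ratioInvariant h.p_unit h.r_unit hne
  have hV' : φ θ * (θ + ratioInvariant p r)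
      + scaledNorm θ e f * (φ θ + ratioInvariant p r) = 0 := by
    have := congrArg φ hV
    simp only [map_mul, map_add, map_scaledNorm, hee, hff, hθθ, hu, map_zero] at this
    linear_combination this
  rw [hV, hV'] at h₁ h₂
  rw [mul_zero, zero_add, add_zero] at h₁
  have hS := (mul_eq_zero.1 h₁).resolve_left h.p_ne
  rw [mul_zero, zero_add, add_zero] at h₂
  have hT := (mul_eq_zero.1 h₂).resolve_left h.r_ne
  exact coefficients_not_all_zero hTr hθ hθθ hu n hS hT hV'

/-- When `p ≠ r`, a solution pair is determined by the ratio `r / p`. -/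
theorem SolutionPair.eq_of_ratio_eq (h₁ : SolutionPair φ θ e f p₁ r₁)
    (h₂ : SolutionPair φ θ e f p₂ r₂) (hne : p₁ ≠ r₁) (hr : r₁ * p₂ = p₁ * r₂) :
    p₁ = p₂ ∧ r₁ = r₂ := by
  have hne₂ : p₂ ≠ r₂ := by
    rintro rfl
    exact hne (mul_right_cancel₀ h₂.p_ne hr).symm
  have n₂ := add_ne_zero_of_ne hne₂
  have hu : ratioInvariant p₁ r₁ = ratioInvariant p₂ r₂ := by
    unfold ratioInvariant
    rw [div_eq_div_iff (pow_ne_zero 2 (add_ne_zero_of_ne hne)) (pow_ne_zero 2 n₂)]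
    linear_combination (norm := (clear * -; grind)) (p₁ * p₂ + r₁ * r₂) * hr
  have V := h₂.leading_ne hTr hθ hθθ hee hff hne₂
  obtain ⟨a₁, b₁, -, -⟩ := h₁.reduced hne rfl rfl
  obtain ⟨a₂, b₂, -, -⟩ := h₂.reduced hne₂ rfl rfl
  rw [hu] at a₁ b₁
  have hp : p₁ = p₂ := by
    refine mul_right_cancel₀ (mul_ne_zero (mul_ne_zero h₁.p_ne (pow_ne_zero 2 n₂)) V) ?_
    obtain ⟨v, hv⟩ : ∃ v, v = θ + ratioInvariant p₂ r₂ := ⟨_, rfl⟩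
    obtain ⟨v', hv'⟩ : ∃ v', v' = φ θ + ratioInvariant p₂ r₂ := ⟨_, rfl⟩
    obtain ⟨w, hw⟩ : ∃ w, w = scaledNorm (φ θ) (φ e) (φ f) * v + θ * v' := ⟨_, rfl⟩
    obtain ⟨S, hS⟩ : ∃ S, S = φ f * v + f * v' := ⟨_, rfl⟩
    obtain ⟨T, hT⟩ : ∃ T, T = φ e * v + e * v' := ⟨_, rfl⟩
    rw [← hv, ← hv', ← hw] at a₁ b₁ a₂ b₂ ⊢
    rw [← hS] at a₁ a₂
    rw [← hT] at b₁ b₂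
    have c₁ : (p₁ + r₁) ^ 2 * w = p₁ * S + r₁ * T := by
      linear_combination (norm := (clear * -; grind)) a₁ + b₁
    have c₂ : (p₂ + r₂) ^ 2 * w = p₂ * S + r₂ * T := by
      linear_combination (norm := (clear * -; grind)) a₂ + b₂
    have c₃ : p₂ * (p₁ + r₁) = p₁ * (p₂ + r₂) := by linear_combination hr
    calc p₁ * (p₁ * (p₂ + r₂) ^ 2 * w) = (p₁ * (p₂ + r₂)) ^ 2 * w := by ring
      _ = p₂ ^ 2 * ((p₁ + r₁) ^ 2 * w) := by rw [← c₃]; ring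
      _ = p₂ * p₁ * (p₂ * S + r₂ * T) := by rw [c₁]; linear_combination p₂ * T * hr
      _ = p₂ * (p₁ * (p₂ + r₂) ^ 2 * w) := by rw [← c₂]; ring
  refine ⟨hp, mul_right_cancel₀ h₂.p_ne ?_⟩
  rw [hr, hp, mul_comm]

omit hθ hTr hθθ hee hff in
theorem SolutionPair.diagonal (h : SolutionPair φ θ e f p p) :
    e + φ e = f + φ f ∧ p ^ 2 * (scaledNorm (φ θ) (φ e) (φ f) + θ) + p * (f + φ f)
      + (φ θ + scaledNorm θ e f) = 0 := by
  have hs : ∀ x : K, scaledNorm x p p = p ^ 2 := fun x => by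
    rw [scaledNorm, CharTwo.add_self_eq_zero]; ring
  have l := h.left
  have r := h.right
  simp only [hs] at l r
  have n := h.p_ne
  refine ⟨CharTwo.add_eq_zero.1 (mul_left_cancel₀ (pow_ne_zero 3 n) ?_),
    mul_left_cancel₀ (pow_ne_zero 2 n) ?_⟩
  · linear_combination (norm := (clear * -; grind)) l + r
  · linear_combination l

omit hee hff in
theorem eq_one_of_add_scaledNorm_eq_zero (he : φ e = e) (hf : φ f = f)
    (h : θ + scaledNorm θ e f = 0 ∨ φ θ + scaledNorm θ e f = 0) : (e + f) ^ 2 = 1 := by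
  refine CharTwo.add_eq_zero.1
    ((mul_eq_zero.1 (?_ : (θ + φ θ) * ((e + f) ^ 2 + 1) = 0)).resolve_left
      (add_map_ne_zero hTr hθ))
  rcases h with h | h <;>
  · have h' := congrArg φ h
    simp only [map_add, map_scaledNorm, he, hf, hθθ, map_zero] at h'
    unfold scaledNorm at h h'
    linear_combination (norm := (clear * -; grind)) h + h'

omit hee hff in
/-- When the quadratic equation for `ratioInvariant` degenerates to `0 = 0`, the value `e + f * c`
is `1` or `c`. -/
theorem exceptional_of_mul_eq_zero (he : φ e = e) (hf : φ f = f)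
    (h : (θ + scaledNorm θ e f) * (φ θ + scaledNorm (φ θ) (φ e) (φ f)) = 0) :
    (e = 1 ∧ f = 0) ∨ (e = 0 ∧ f = 1) := by
  have h0 : θ + scaledNorm θ e f = 0 := by
    rw [← map_scaledNorm, ← map_add] at h
    rcases mul_eq_zero.1 h with h | h
    · exact h
    · exact (map_eq_zero φ).1 h
  have h1 := eq_one_of_add_scaledNorm_eq_zero hTr hθ hθθ he hf (Or.inl h0)
  have h2 : e + f = 1 := by
    have : (e + f + 1) ^ 2 = 0 := by
      linear_combination (norm := (clear * -; grind)) h1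
    exact CharTwo.add_eq_zero.1 (pow_eq_zero_iff two_ne_zero |>.1 this)
  rw [scaledNorm, h1, mul_one, ← add_assoc, CharTwo.add_self_eq_zero, zero_add] at h0
  rcases mul_eq_zero.1 h0 with h | h
  · exact Or.inr ⟨h, by simpa [h] using h2⟩
  · exact Or.inl ⟨by simpa [h] using h2, h⟩

theorem SolutionPair.diagonal_leading_ne (h : SolutionPair φ θ e f p p) :
    scaledNorm (φ θ) (φ e) (φ f) + θ ≠ 0 := fun h0 => by
  obtain ⟨hE, hq⟩ := h.diagonal
  have h1 : φ θ + scaledNorm θ e f = 0 := by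
    have := congrArg φ h0
    simp only [map_add, map_scaledNorm, hθθ, hee, hff, map_zero] at this
    rw [add_comm, this]
  rw [h0, h1, mul_zero, zero_add, add_zero] at hq
  have hf0 := (mul_eq_zero.1 hq).resolve_left h.p_ne
  have hf := (CharTwo.add_eq_zero.1 hf0).symm
  have he := (CharTwo.add_eq_zero.1 (hE.trans hf0)).symm
  have hg := eq_one_of_add_scaledNorm_eq_zero hTr hθ hθθ he hf (Or.inr h1)
  have h2 : f = e + 1 := by
    have : (e + f + 1) ^ 2 = 0 := by
      linear_combination (norm := (clear * -; grind)) hg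
    have := pow_eq_zero_iff two_ne_zero |>.1 this
    linear_combination (norm := (clear * -; grind)) this
  refine add_map_ne hTr hθ he ?_
  rw [scaledNorm, hg, h2] at h1
  linear_combination (norm := (clear * -; grind)) h1

theorem SolutionPair.diagonal_three (h₁ : SolutionPair φ θ e f p₁ p₁)
    (h₂ : SolutionPair φ θ e f p₂ p₂) (h₃ : SolutionPair φ θ e f p₃ p₃) :
    p₁ = p₂ ∨ p₁ = p₃ ∨ p₂ = p₃ := by
  by_contra! hne
  obtain ⟨n12, n13, n23⟩ := hne
  have q₁ := h₁.diagonal.2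
  have q₂ := h₂.diagonal.2
  have q₃ := h₃.diagonal.2
  have a₂ := mul_left_cancel₀ (sub_ne_zero.2 n12)
    (show (p₁ - p₂) * ((p₁ + p₂) * (scaledNorm (φ θ) (φ e) (φ f) + θ) + (f + φ f)) = (p₁ - p₂) * 0
      by linear_combination q₁ - q₂)
  have a₃ := mul_left_cancel₀ (sub_ne_zero.2 n13)
    (show (p₁ - p₃) * ((p₁ + p₃) * (scaledNorm (φ θ) (φ e) (φ f) + θ) + (f + φ f)) = (p₁ - p₃) * 0
      by linear_combination q₁ - q₃)
  exact n23 (mul_right_cancel₀ (h₁.diagonal_leading_ne hTr hθ hθθ hee hff)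
    (by linear_combination a₂ - a₃))

/-- Pairs with `p = r` and pairs with `p ≠ r` do not occur together: each kind forces its own
constant to have trace one, and the two constants differ by an element of trace one. -/
theorem SolutionPair.not_diagonal_of_ne (hex : ¬((e = 1 ∧ f = 0) ∨ (e = 0 ∧ f = 1)))
    (h₁ : SolutionPair φ θ e f p₁ p₁) (h₂ : SolutionPair φ θ e f p₂ r₂) : p₂ = r₂ := by
  by_contra hne
  obtain ⟨hE, hq⟩ := h₁.diagonal
  have hQ := h₂.quadratic hne
  have ht := trace_ratioInvariant hTr h₂.p_unit h₂.r_unit hne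
  obtain ⟨E, hEd⟩ : ∃ E, E = f + φ f := ⟨_, rfl⟩
  have hD : e + φ e + f + φ f = 0 := by
    rw [add_assoc, hE, CharTwo.add_self_eq_zero]
  have hEE : φ E = E := by rw [hEd]; exact map_add_map hff
  rw [hD, hE, ← hEd] at hQ
  have hu : E ^ 2 * ratioInvariant p₂ r₂
      = (θ + scaledNorm θ e f) * (φ θ + scaledNorm (φ θ) (φ e) (φ f)) := by
    linear_combination (norm := (clear * -; grind)) hQ
  have hE0 : E ≠ 0 := by
    intro h0
    rw [h0] at hu hEd
    rw [← hEd] at hE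
    refine hex (exceptional_of_mul_eq_zero hTr hθ hθθ (CharTwo.add_eq_zero.1 hE).symm
      (CharTwo.add_eq_zero.1 hEd.symm).symm ?_)
    rw [← hu]; ring
  rw [← hEd] at hq
  obtain ⟨A, hA⟩ : ∃ A, A = φ θ + scaledNorm θ e f := ⟨_, rfl⟩
  obtain ⟨A', hA'⟩ : ∃ A', A' = scaledNorm (φ θ) (φ e) (φ f) + θ := ⟨_, rfl⟩
  have hAA : φ A' = A := by
    rw [hA, hA', map_add, map_scaledNorm, hθθ, hee, hff, add_comm]
  rw [← hA, ← hA'] at hq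
  have p0 := h₁.p_ne
  -- The constant of the quadratic equation for `p₁` is `y ^ 2 + y` with `φ y = y + 1`.
  have hy : Tr (A * A' / E ^ 2) = 1 := by
    have e1 : A * A' / E ^ 2 = (p₁ * A' / E) ^ 2 + p₁ * A' / E := by
      field_simp
      linear_combination (norm := (clear * -; grind)) A' * hq
    have e2 : φ (p₁ * A' / E) = A / (p₁ * E) := by
      rw [map_div₀, map_mul, hAA, hEE, div_eq_div_iff hE0 (mul_ne_zero p0 hE0)]
      linear_combination A * E * h₁.p_unit
    rw [e1, hTr, e2]
    field_simp
    linear_combination (norm := (clear * -; grind)) hq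
  have hg : φ ((e + f) / E) = (e + f) / E := by
    rw [map_div₀, map_add, hEE]
    congr 1
    linear_combination (norm := (clear * -; grind)) hE
  have key : A * A' / E ^ 2 = ratioInvariant p₂ r₂ + ((θ + φ θ)
      + (((θ + φ θ) * ((e + f) / E)) ^ 2 + (θ + φ θ) * ((e + f) / E))) := by
    field_simp
    rw [hu, hA, hA', scaledNorm, scaledNorm, hEd]
    have he : φ e = f + φ f + e := by
      linear_combination (norm := (clear * -; grind)) hE
    rw [he]
    clear * -
    grind
  have hz := trace_eq_zero_of_map_eq hTr (y := (θ + φ θ) * ((e + f) / E))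
    (by rw [map_mul, hg, map_add_map hθθ])
  rw [key, map_add, map_add, ht, hθ, hz, add_zero, CharTwo.add_self_eq_zero] at hy
  exact zero_ne_one hy

/-- The value `e + f * c` determines `ratioInvariant p r`: two distinct roots of the quadratic
equation have a sum of trace one, so they do not both have trace one. -/
theorem SolutionPair.ratioInvariant_eq (hex : ¬((e = 1 ∧ f = 0) ∨ (e = 0 ∧ f = 1)))
    (h₁ : SolutionPair φ θ e f p₁ r₁) (h₂ : SolutionPair φ θ e f p₂ r₂)
    (n₁ : p₁ ≠ r₁) (n₂ : p₂ ≠ r₂) : ratioInvariant p₁ r₁ = ratioInvariant p₂ r₂ := by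
  have q₁ := h₁.quadratic n₁
  have q₂ := h₂.quadratic n₂
  have t₁ := trace_ratioInvariant hTr h₁.p_unit h₁.r_unit n₁
  have t₂ := trace_ratioInvariant hTr h₂.p_unit h₂.r_unit n₂
  have hc := exceptional_of_mul_eq_zero hTr hθ hθθ (e := e) (f := f)
  obtain ⟨C, hC⟩ : ∃ C, C = (θ + scaledNorm θ e f)
    * (φ θ + scaledNorm (φ θ) (φ e) (φ f)) := ⟨_, rfl⟩
  obtain ⟨u₁, hu₁⟩ : ∃ u, u = ratioInvariant p₁ r₁ := ⟨_, rfl⟩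
  obtain ⟨u₂, hu₂⟩ : ∃ u, u = ratioInvariant p₂ r₂ := ⟨_, rfl⟩
  obtain ⟨E, hE⟩ : ∃ E, E = e + φ e := ⟨_, rfl⟩
  obtain ⟨H, hH⟩ : ∃ H, H = f + φ f := ⟨_, rfl⟩
  have hφE : φ E = E := by rw [hE, map_add_map hee]
  have hφH : φ H = H := by rw [hH, map_add_map hff]
  rw [add_assoc _ f, ← hC, ← hE, ← hH, ← hu₁] at q₁
  rw [add_assoc _ f, ← hC, ← hE, ← hH, ← hu₂] at q₂
  rw [← hC] at hc
  rw [← hu₁] at t₁ ⊢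
  rw [← hu₂] at t₂ ⊢
  by_contra hne
  have hsum : (E + H) ^ 2 * (u₁ + u₂) + (E * H + (θ + φ θ) * (E + H) ^ 2) = 0 := by
    refine mul_left_cancel₀ (sub_ne_zero.2 hne) ?_
    linear_combination q₁ - q₂
  by_cases hD : E + H = 0
  · have hEH : E = H := CharTwo.add_eq_zero.1 hD
    have h0 : H = 0 := by
      rw [hD, hEH] at hsum
      simpa using hsum
    have hE0 : E = 0 := hEH.trans h0
    rw [hD, hE0, h0] at q₁
    rw [h0] at hH
    rw [hE0] at hE
    exact hex (hc (CharTwo.add_eq_zero.1 hE.symm).symm (CharTwo.add_eq_zero.1 hH.symm).symm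
      (by simpa using q₁))
  · have key : u₁ + u₂ = (θ + φ θ) + ((E / (E + H)) ^ 2 + E / (E + H)) := by
      refine mul_left_cancel₀ (pow_ne_zero 2 hD) ?_
      field_simp
      linear_combination (norm := (clear * -; grind)) hsum
    have hz := trace_eq_zero_of_map_eq hTr (y := E / (E + H))
      (by rw [map_div₀, map_add, hφE, hφH])
    have := congrArg Tr key
    rw [map_add, map_add, t₁, t₂, hθ, hz, CharTwo.add_self_eq_zero, add_zero] at this
    exact zero_ne_one this

/-- A value other than `1` and `c` admits at most two solution pairs. -/
theorem SolutionPair.three (hex : ¬((e = 1 ∧ f = 0) ∨ (e = 0 ∧ f = 1)))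
    (h₁ : SolutionPair φ θ e f p₁ r₁) (h₂ : SolutionPair φ θ e f p₂ r₂)
    (h₃ : SolutionPair φ θ e f p₃ r₃) :
    (p₁ = p₂ ∧ r₁ = r₂) ∨ (p₁ = p₃ ∧ r₁ = r₃) ∨ (p₂ = p₃ ∧ r₂ = r₃) := by
  by_cases n₁ : p₁ = r₁
  · subst n₁
    obtain rfl := h₁.not_diagonal_of_ne hTr hθ hθθ hee hff hex h₂
    obtain rfl := h₁.not_diagonal_of_ne hTr hθ hθθ hee hff hex h₃
    simpa using h₁.diagonal_three hTr hθ hθθ hee hff h₂ h₃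
  have n₂ : p₂ ≠ r₂ := by
    rintro rfl
    exact n₁ (h₂.not_diagonal_of_ne hTr hθ hθθ hee hff hex h₁)
  have n₃ : p₃ ≠ r₃ := by
    rintro rfl
    exact n₁ (h₃.not_diagonal_of_ne hTr hθ hθθ hee hff hex h₁)
  have u₂ := h₁.ratioInvariant_eq hTr hθ hθθ hee hff hex h₂ n₁ n₂
  have u₃ := h₁.ratioInvariant_eq hTr hθ hθθ hee hff hex h₃ n₁ n₃
  rcases ratio_eq_or_of_ratioInvariant_eq n₁ n₂ u₂ with k₂ | k₂
  · exact Or.inl (h₁.eq_of_ratio_eq hTr hθ hθθ hee hff h₂ n₁ k₂)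
  rcases ratio_eq_or_of_ratioInvariant_eq n₁ n₃ u₃ with k₃ | k₃
  · exact Or.inr (Or.inl (h₁.eq_of_ratio_eq hTr hθ hθθ hee hff h₃ n₁ k₃))
  refine Or.inr (Or.inr (h₂.eq_of_ratio_eq hTr hθ hθθ hee hff h₃ n₂ ?_))
  refine mul_left_cancel₀ (mul_ne_zero h₁.r_ne h₁.p_ne) ?_
  linear_combination p₁ * p₃ * k₂ - p₁ * p₂ * k₃

end Trace
end Pairs

/-! ### From solutions to pairs -/

section Solutions

variable {K : Type*} [Field K] [CharP K 2] {φ : K →+* K} {d : ℕ} {c e f : K}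

theorem add_inv_ne_zero {c' : K} (hc : c * c' = 1) (hc1 : c ≠ 1) : c + c' ≠ 0 := fun h => by
  rw [← CharTwo.add_eq_zero.1 h, ← sq] at hc
  exact hc1 (CharTwo.sq_inj.1 (hc.trans (one_pow 2).symm))

section Theta

variable (hc : c * φ (φ c) = 1) (hc1 : c ≠ 1)
include hc hc1

theorem theta_mul : c / (1 + c) ^ 2 * (c + φ (φ c)) = 1 := by
  have h1 : 1 + c ≠ 0 := add_ne_zero_of_ne hc1.symm
  field_simp
  linear_combination (norm := (clear * -; grind)) hc

/-- The factorization that makes `scaledNorm` a multiple of the norm form. -/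
theorem scaledNorm_theta (x y : K) :
    scaledNorm (c / (1 + c) ^ 2) x y = c / (1 + c) ^ 2 * ((x + c * y) * (x + φ (φ c) * y)) := by
  rw [scaledNorm]
  linear_combination (norm := (clear * -; grind))
    x * y * theta_mul hc hc1 + c / (1 + c) ^ 2 * y ^ 2 * hc

theorem root_add_conj : c / (1 + c) + φ (φ (c / (1 + c))) = 1 := by
  have h1 : 1 + c ≠ 0 := add_ne_zero_of_ne hc1.symm
  have h2 : 1 + φ (φ c) ≠ 0 := by
    have : φ (φ (1 + c)) ≠ 0 := (map_ne_zero φ).2 ((map_ne_zero φ).2 h1)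
    simpa only [map_add, map_one] using this
  simp only [map_div₀, map_add, map_one]
  field_simp
  linear_combination (norm := (clear * -; grind)) hc

omit hc in
/-- `θ` is of the form `y ^ 2 + y` over `𝔽_{q⁴}`, but not over `𝔽_{q²}`. -/
theorem theta_eq : c / (1 + c) ^ 2 = (c / (1 + c)) ^ 2 + c / (1 + c) := by
  have h1 : 1 + c ≠ 0 := add_ne_zero_of_ne hc1.symm
  field_simp
  clear * -
  grind

theorem map_map_theta : φ (φ (c / (1 + c) ^ 2)) = c / (1 + c) ^ 2 := by
  have h := root_add_conj hc hc1
  have h2 : φ (φ (c / (1 + c))) = 1 + c / (1 + c) := by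
    linear_combination (norm := (clear * -; grind)) h
  rw [theta_eq hc1, map_add, map_add, map_pow, map_pow, h2]
  clear * -
  grind

theorem trace_theta {Tr : K →+ K} (hTr : ∀ y, Tr (y ^ 2 + y) = φ y + y) :
    Tr (c / (1 + c) ^ 2 + φ (c / (1 + c) ^ 2)) = 1 := by
  rw [map_add Tr, theta_eq hc1, map_add φ, map_pow φ, hTr, hTr]
  linear_combination (norm := (clear * -; grind)) root_add_conj hc hc1

/-- `1` and `c` span `𝔽_{q⁴}` over `𝔽_{q²}`. -/
theorem exists_coordinates (h4 : ∀ x, φ (φ (φ (φ x))) = x) (b : K) :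
    ∃ e f : K, b = e + f * c ∧ φ (φ e) = e ∧ φ (φ f) = f := by
  have n := add_inv_ne_zero hc hc1
  have hf : φ (φ ((b + φ (φ b)) / (c + φ (φ c)))) = (b + φ (φ b)) / (c + φ (φ c)) := by
    simp only [map_div₀, map_add, h4]
    rw [add_comm b, add_comm c]
  refine ⟨b + (b + φ (φ b)) / (c + φ (φ c)) * c, (b + φ (φ b)) / (c + φ (φ c)), ?_, ?_, hf⟩
  · rw [add_assoc, CharTwo.add_self_eq_zero, add_zero]
  · rw [map_add, map_add, map_mul, map_mul, hf]
    field_simp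
    clear * -
    grind

end Theta

variable (hd : ∀ x : K, x ^ d * x = φ x * φ (φ x) * φ (φ (φ x)))

omit [CharP K 2] in
include hd in
theorem pow_eq_ratio_mul {x : K} (hx : x ≠ 0) :
    x ^ d = φ (x * φ (φ x)) / (x * φ (φ x)) * φ (φ x) ^ 2 := by
  have h1 : φ (φ x) ≠ 0 := by simpa using hx
  refine mul_right_cancel₀ hx ?_
  rw [hd, map_mul]
  field_simp

omit [CharP K 2] in
/-- The function `x ↦ x ^ (q - 1)` on `𝔽_{q²}` takes values of norm one over `𝔽_q`. -/
theorem ratio_mul_map_ratio {m : K} (hm : m ≠ 0) (hmm : φ (φ m) = m) :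
    φ m / m * φ (φ m / m) = 1 := by
  have : φ m ≠ 0 := by simpa using hm
  rw [map_div₀, hmm]
  field_simp

omit [CharP K 2] in
/-- How `scaledNorm` behaves under inversion of both arguments. -/
theorem scaledNorm_unit {θ p r p' r' : K} (hp : p * p' = 1) (hr : r * r' = 1) :
    p ^ 2 * r ^ 2 * scaledNorm θ p' r' = scaledNorm θ p r := by
  have h3 : p * r * (p' + r') = p + r := by linear_combination r * hp + p * hr
  calc p ^ 2 * r ^ 2 * scaledNorm θ p' r'
      = θ * (p * r * (p' + r')) ^ 2 + p * r * (p * p') * (r * r') := by rw [scaledNorm]; ring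
    _ = scaledNorm θ p r := by rw [h3, hp, hr, scaledNorm]; ring

variable (h4 : ∀ x, φ (φ (φ (φ x))) = x) (hc : c * φ (φ c) = 1) (hc1 : c ≠ 1)
include hd h4 hc hc1

/-- The pair equations arise from `φ (N x) = r * N x` and `φ (N (x + 1)) = p * N (x + 1)`, the norms
being computed from the linear equation for `φ (φ x) ^ 2`. -/
theorem exists_solutionPair {x : K} (hx : x ≠ 0) (hx1 : x ≠ 1) (hee : φ (φ e) = e)
    (hff : φ (φ f) = f) (hb : (x + 1) ^ d + c * x ^ d = e + f * c) :
    ∃ p r, SolutionPair φ (c / (1 + c) ^ 2) e f p r ∧ p + c * r ≠ 0 ∧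
      φ (φ x) ^ 2 * (p + c * r) = e + f * c + p := by
  have hx1' : x + 1 ≠ 0 := add_ne_zero_of_ne hx1
  have hX := pow_eq_ratio_mul hd hx
  have hX1 := pow_eq_ratio_mul hd hx1'
  obtain ⟨θ, hθ⟩ : ∃ θ, θ = c / (1 + c) ^ 2 := ⟨_, rfl⟩
  have hsc := scaledNorm_theta hc hc1
  have hθ0 : θ ≠ 0 := hθ ▸ left_ne_zero_of_mul_eq_one (theta_mul hc hc1)
  rw [← hθ] at hsc ⊢
  obtain ⟨M, hM⟩ : ∃ M, M = x * φ (φ x) := ⟨_, rfl⟩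
  obtain ⟨M₁, hM₁⟩ : ∃ M, M = (x + 1) * φ (φ (x + 1)) := ⟨_, rfl⟩
  have hMM : φ (φ M) = M := by rw [hM, map_mul, map_mul, h4, mul_comm]
  have hMM₁ : φ (φ M₁) = M₁ := by rw [hM₁, map_mul, map_mul, h4, mul_comm]
  have hM0 : M ≠ 0 := by rw [hM]; exact mul_ne_zero hx (by simpa using hx)
  have hM10 : M₁ ≠ 0 := by
    rw [hM₁]; exact mul_ne_zero hx1' ((map_ne_zero φ).2 ((map_ne_zero φ).2 hx1'))
  have hr := ratio_mul_map_ratio hM0 hMM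
  have hp := ratio_mul_map_ratio hM10 hMM₁
  rw [← hM] at hX
  rw [← hM₁] at hX1
  obtain ⟨r, hrd⟩ : ∃ r, r = φ M / M := ⟨_, rfl⟩
  obtain ⟨p, hpd⟩ : ∃ p, p = φ M₁ / M₁ := ⟨_, rfl⟩
  have hφM : φ M = r * M := by rw [hrd]; field_simp
  have hφM₁ : φ M₁ = p * M₁ := by rw [hpd]; field_simp
  have hrr : φ (φ r) = r := by rw [hrd, map_div₀, map_div₀, hMM]
  have hpp : φ (φ p) = p := by rw [hpd, map_div₀, map_div₀, hMM₁]
  rw [← hrd] at hr hX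
  rw [← hpd] at hp hX1
  have hp0 := left_ne_zero_of_mul_eq_one hp
  have hr0 := left_ne_zero_of_mul_eq_one hr
  obtain ⟨y, hy⟩ : ∃ y, y = φ (φ x) := ⟨_, rfl⟩
  have hyx : φ (φ y) = x := by rw [hy, h4]
  rw [← hy] at hM hX ⊢
  rw [map_add, map_add, map_one, map_one, ← hy] at hX1 hM₁
  rw [hX, hX1] at hb
  have k₁ : y ^ 2 * (p + c * r) = e + f * c + p := by
    linear_combination (norm := (clear * -; grind)) hb
  have k₂ : (y + 1) ^ 2 * (p + c * r) = e + f * c + c * r := by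
    linear_combination (norm := (clear * -; grind)) hb
  have k₁' := congrArg (fun z => φ (φ z)) k₁
  have k₂' := congrArg (fun z => φ (φ z)) k₂
  simp only [map_mul, map_add, map_pow, map_one, hyx, hpp, hrr, hee, hff] at k₁' k₂'
  have n : p + c * r ≠ 0 := by
    intro h0
    have hpc : p = c * r := CharTwo.add_eq_zero.1 h0
    have h1 := congrArg (fun z => φ (φ z)) hpc
    simp only [map_mul, hpp, hrr] at h1
    refine add_inv_ne_zero hc hc1 ?_
    rw [← mul_right_cancel₀ hr0 (hpc.symm.trans h1)]
    exact CharTwo.add_self_eq_zero c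
  have n' : p + φ (φ c) * r ≠ 0 := by
    have : φ (φ (p + c * r)) ≠ 0 := (map_ne_zero φ).2 ((map_ne_zero φ).2 n)
    simpa only [map_add, map_mul, hpp, hrr] using this
  have hV : scaledNorm θ p r ≠ 0 := by
    rw [hsc]; exact mul_ne_zero hθ0 (mul_ne_zero n n')
  have hV' : scaledNorm (φ θ) p r ≠ 0 := by
    rw [← scaledNorm_unit hp hr, ← map_scaledNorm]
    exact mul_ne_zero (mul_ne_zero (pow_ne_zero 2 hp0) (pow_ne_zero 2 hr0))
      ((map_ne_zero φ).2 hV)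
  have m₁ : M ^ 2 * scaledNorm θ p r = scaledNorm θ (e + p) f := by
    rw [hsc, hsc, hM]
    calc (x * y) ^ 2 * (θ * ((p + c * r) * (p + φ (φ c) * r)))
        = θ * ((y ^ 2 * (p + c * r)) * (x ^ 2 * (p + φ (φ c) * r))) := by ring
      _ = _ := by rw [k₁, k₁']; ring
  have m₂ : M₁ ^ 2 * scaledNorm θ p r = scaledNorm θ e (f + r) := by
    rw [hsc, hsc, hM₁]
    calc ((x + 1) * (y + 1)) ^ 2 * (θ * ((p + c * r) * (p + φ (φ c) * r)))
        = θ * (((y + 1) ^ 2 * (p + c * r)) * ((x + 1) ^ 2 * (p + φ (φ c) * r))) := by ring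
      _ = _ := by rw [k₂, k₂']; ring
  have m₁' : M ^ 2 * scaledNorm (φ θ) p r = scaledNorm (φ θ) (p * φ e + 1) (p * φ f) := by
    have h := congrArg φ m₁
    rw [map_mul, map_pow, map_scaledNorm, map_scaledNorm, map_add, hφM] at h
    calc M ^ 2 * scaledNorm (φ θ) p r
        = p ^ 2 * ((r * M) ^ 2 * scaledNorm (φ θ) (φ p) (φ r)) := by
          rw [← scaledNorm_unit hp hr]; ring
      _ = scaledNorm (φ θ) (p * φ e + p * φ p) (p * φ f) := by
          rw [h, scaledNorm, scaledNorm]; ring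
      _ = _ := by rw [hp]
  have m₂' : M₁ ^ 2 * scaledNorm (φ θ) p r = scaledNorm (φ θ) (r * φ e) (r * φ f + 1) := by
    have h := congrArg φ m₂
    rw [map_mul, map_pow, map_scaledNorm, map_scaledNorm, map_add, hφM₁] at h
    calc M₁ ^ 2 * scaledNorm (φ θ) p r
        = r ^ 2 * ((p * M₁) ^ 2 * scaledNorm (φ θ) (φ p) (φ r)) := by
          rw [← scaledNorm_unit hp hr]; ring
      _ = scaledNorm (φ θ) (r * φ e) (r * φ f + r * φ r) := by
          rw [h, scaledNorm, scaledNorm]; ring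
      _ = _ := by rw [hr]
  refine ⟨p, r, ⟨hp, hr, ?_, ?_, hV, hV'⟩, n, k₁⟩
  · have : scaledNorm θ p r * scaledNorm (φ θ) (p * φ e + 1) (p * φ f)
        = scaledNorm (φ θ) p r * scaledNorm θ (e + p) f := by rw [← m₁, ← m₁']; ring
    rw [scaledNorm.eq_1 (φ θ) (p * φ e + 1), scaledNorm.eq_1 θ (e + p)] at this
    rw [scaledNorm.eq_1 (φ θ) (φ e), scaledNorm.eq_1 θ e]
    linear_combination (norm := (clear * -; grind)) this
  · have : scaledNorm θ p r * scaledNorm (φ θ) (r * φ e) (r * φ f + 1)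
        = scaledNorm (φ θ) p r * scaledNorm θ e (f + r) := by rw [← m₂, ← m₂']; ring
    rw [scaledNorm.eq_1 (φ θ) (r * φ e), scaledNorm.eq_1 θ e] at this
    rw [scaledNorm.eq_1 (φ θ) (φ e), scaledNorm.eq_1 θ e]
    linear_combination (norm := (clear * -; grind)) this

/-! ### The number of solutions for shift one -/

variable {Tr : K →+ K} (hTr : ∀ y, Tr (y ^ 2 + y) = φ y + y)
include hTr

omit hd h4 in
theorem crossed_ne_zero {p r : K} (hp : p ≠ 0) (hr : r ≠ 0) :
    φ (c / (1 + c) ^ 2) * scaledNorm (c / (1 + c) ^ 2) p r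
      + c / (1 + c) ^ 2 * scaledNorm (φ (c / (1 + c) ^ 2)) p r ≠ 0 := by
  have h := mul_ne_zero (mul_ne_zero hp hr)
    (add_map_ne_zero hTr (trace_theta hc hc1 hTr))
  refine fun h0 => h ?_
  rw [← h0]
  unfold scaledNorm
  clear * -
  grind

/-- The value `1`, attained at `0`, is attained only there. -/
theorem eq_zero_of_value_one {x : K} (hx1 : x ≠ 1) (hb : (x + 1) ^ d + c * x ^ d = 1) :
    x = 0 := by
  by_contra hx
  obtain ⟨p, r, h, n, k⟩ := exists_solutionPair hd h4 hc hc1 hx hx1 (e := 1) (f := 0)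
    (by simp) (by simp) (by rw [hb]; ring)
  have hl := h.left
  simp only [map_one, map_zero] at hl
  have h1 := crossed_ne_zero hc hc1 hTr h.p_ne h.r_ne
  have hp : p = 1 := by
    refine CharTwo.sq_inj.1 (mul_right_cancel₀ h1 (CharTwo.add_eq_zero.1 ?_))
    rw [← hl]
    have hs : ∀ y : K, scaledNorm y 1 0 = y := fun y => by simp [scaledNorm]
    rw [hs, hs]
    ring
  rw [hp] at k n
  have : φ (φ x) ^ 2 = 0 := by
    refine (mul_eq_zero.1 (k.trans ?_)).resolve_right n
    rw [zero_mul, add_zero, CharTwo.add_self_eq_zero]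
  exact hx (by simpa using this)

/-- The value `c`, attained at `1`, is attained only there. -/
theorem eq_one_of_value_c {x : K} (hx : x ≠ 0) (hb : (x + 1) ^ d + c * x ^ d = c) :
    x = 1 := by
  by_contra hx1
  obtain ⟨p, r, h, n, k⟩ := exists_solutionPair hd h4 hc hc1 hx hx1 (e := 0) (f := 1)
    (by simp) (by simp) (by rw [hb]; ring)
  have hl := h.right
  simp only [map_one, map_zero] at hl
  have h1 := crossed_ne_zero hc hc1 hTr h.p_ne h.r_ne
  have hr : r = 1 := by
    refine CharTwo.sq_inj.1 (mul_right_cancel₀ h1 (CharTwo.add_eq_zero.1 ?_))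
    rw [← hl]
    have hs : ∀ y : K, scaledNorm y 0 1 = y := fun y => by simp [scaledNorm]
    rw [hs, hs]
    ring
  rw [hr] at k n
  have h2 : φ (φ x) = 1 := by
    refine CharTwo.sq_inj.1 (mul_right_cancel₀ n (k.trans ?_))
    ring
  rw [← map_one φ, ← map_one φ] at h2
  exact hx1 (φ.injective (φ.injective h2))

/-- Among three solutions with the same value two coincide. -/
theorem three_solutions (hd0 : d ≠ 0) {x y z b : K} (hx : (x + 1) ^ d + c * x ^ d = b)
    (hy : (y + 1) ^ d + c * y ^ d = b) (hz : (z + 1) ^ d + c * z ^ d = b) :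
    x = y ∨ x = z ∨ y = z := by
  have v0 : ∀ w : K, w = 0 → (w + 1) ^ d + c * w ^ d = 1 := by
    rintro w rfl; simp [hd0]
  have v1 : ∀ w : K, w = 1 → (w + 1) ^ d + c * w ^ d = c := by
    rintro w rfl; simp [hd0, CharTwo.add_self_eq_zero]
  by_cases hb1 : b = 1
  · have key : ∀ w : K, (w + 1) ^ d + c * w ^ d = b → w = 0 := fun w hw =>
      eq_zero_of_value_one hd h4 hc hc1 hTr
        (fun h => hc1 ((v1 w h).symm.trans (hw.trans hb1))) (hw.trans hb1)
    exact Or.inl ((key x hx).trans (key y hy).symm)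
  by_cases hbc : b = c
  · have key : ∀ w : K, (w + 1) ^ d + c * w ^ d = b → w = 1 := fun w hw =>
      eq_one_of_value_c hd h4 hc hc1 hTr
        (fun h => hb1 (hw.symm.trans (v0 w h))) (hw.trans hbc)
    exact Or.inl ((key x hx).trans (key y hy).symm)
  obtain ⟨e, f, hef, hee, hff⟩ := exists_coordinates hc hc1 h4 b
  have hex : ¬((e = 1 ∧ f = 0) ∨ (e = 0 ∧ f = 1)) := by
    rintro (⟨rfl, rfl⟩ | ⟨rfl, rfl⟩)
    · exact hb1 (by simpa using hef)
    · exact hbc (by simpa using hef)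
  have key : ∀ w : K, (w + 1) ^ d + c * w ^ d = b →
      ∃ p r, SolutionPair φ (c / (1 + c) ^ 2) e f p r ∧ p + c * r ≠ 0 ∧
        φ (φ w) ^ 2 * (p + c * r) = e + f * c + p := fun w hw =>
    exists_solutionPair hd h4 hc hc1 (fun h => hb1 (hw.symm.trans (v0 w h)))
      (fun h => hbc (hw.symm.trans (v1 w h))) hee hff (hw.trans hef)
  have inj : ∀ (w w' p r : K), p + c * r ≠ 0 → φ (φ w) ^ 2 * (p + c * r) = e + f * c + p →
      φ (φ w') ^ 2 * (p + c * r) = e + f * c + p → w = w' := fun w w' p r n h h' =>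
    φ.injective (φ.injective (CharTwo.sq_injective (mul_right_cancel₀ n (h.trans h'.symm))))
  obtain ⟨p₁, r₁, s₁, n₁, k₁⟩ := key x hx
  obtain ⟨p₂, r₂, s₂, n₂, k₂⟩ := key y hy
  obtain ⟨p₃, r₃, s₃, n₃, k₃⟩ := key z hz
  rcases s₁.three hTr (trace_theta hc hc1 hTr) (map_map_theta hc hc1) hee hff hex s₂ s₃ with
    ⟨rfl, rfl⟩ | ⟨rfl, rfl⟩ | ⟨rfl, rfl⟩
  · exact Or.inl (inj _ _ _ _ n₁ k₁ k₂)
  · exact Or.inr (Or.inl (inj _ _ _ _ n₁ k₁ k₃))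
  · exact Or.inr (Or.inr (inj _ _ _ _ n₂ k₂ k₃))

/-- If the map were injective, it would be a bijection intertwining `x ↦ φ (φ x) + 1` and
`b ↦ c * φ (φ b)`, hence a bijection between the fixed points of these involutions; but the fixed
point `(1 + c) * e` with `e ^ 2 = φ θ` is not attained at a fixed point. -/
theorem not_injective [Finite K] :
    ¬Function.Injective fun x : K => (x + 1) ^ d + c * x ^ d := fun hinj => by
  have hc1' : 1 + c ≠ 0 := add_ne_zero_of_ne hc1.symm
  have hθ := trace_theta hc hc1 hTr
  have hθθ := map_map_theta hc hc1
  have hθy := theta_eq hc1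
  obtain ⟨θ, hθd⟩ : ∃ θ, θ = c / (1 + c) ^ 2 := ⟨_, rfl⟩
  obtain ⟨y, hy⟩ : ∃ y, y = c / (1 + c) := ⟨_, rfl⟩
  rw [← hθd] at hθ hθθ hθy
  rw [← hy] at hθy
  have hyc : y * (1 + c) = c := by rw [hy]; field_simp
  obtain ⟨e, he⟩ := isSquare_of_charTwo' (φ θ)
  rw [← sq] at he
  have hee : φ (φ e) = e := by
    refine CharTwo.sq_inj.1 ?_
    rw [← map_pow, ← map_pow, ← he, hθθ]
  -- The value `(1 + c) * e` is fixed by `b ↦ c * φ (φ b)`.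
  obtain ⟨x, hx⟩ := (Finite.injective_iff_surjective.1 hinj) ((1 + c) * e)
  have hxx : φ (φ x) = x + 1 := by
    have h : φ (φ x) + 1 = x := by
      refine hinj (Eq.trans ?_ hx.symm)
      have h2 := congrArg (fun z => c * φ (φ z)) hx
      simp only [map_add, map_mul, map_pow, map_one, hee] at h2
      simp only [add_assoc, CharTwo.add_self_eq_zero, add_zero]
      linear_combination (norm := (clear * -; grind)) h2 + (e - φ (φ x) ^ d) * hc
    rw [← h, add_assoc, CharTwo.add_self_eq_zero, add_zero, h]
  have hx0 : x ≠ 0 := by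
    rintro rfl
    simp at hxx
  have hx1 : x + 1 ≠ 0 := by
    rw [← hxx]; exact (map_ne_zero φ).2 ((map_ne_zero φ).2 hx0)
  have hM0 : x * φ (φ x) ≠ 0 := by rw [hxx]; exact mul_ne_zero hx0 hx1
  have hMM : φ (φ (x * φ (φ x))) = x * φ (φ x) := by rw [map_mul, map_mul, h4, mul_comm]
  have hp := ratio_mul_map_ratio hM0 hMM
  have e₁ := pow_eq_ratio_mul hd hx0
  have e₂ := pow_eq_ratio_mul hd hx1
  have hx2 : φ (φ (x + 1)) = x := by
    rw [map_add, map_add, map_one, map_one, hxx, add_assoc, CharTwo.add_self_eq_zero, add_zero]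
  rw [hx2, mul_comm (x + 1)] at e₂
  rw [hxx] at e₁ hp hM0
  obtain ⟨p, hpd⟩ : ∃ p, p = φ (x * (x + 1)) / (x * (x + 1)) := ⟨_, rfl⟩
  have hpm : p * (x * (x + 1)) = φ (x * (x + 1)) := by rw [hpd]; field_simp
  rw [← hpd] at e₁ e₂ hp
  simp only [e₁, e₂] at hx
  obtain ⟨j, hj⟩ : ∃ j, j = x ^ 2 + y := ⟨_, rfl⟩
  have hpj : p * j = e := by
    refine mul_left_cancel₀ hc1' ?_
    rw [← hx, hj]
    linear_combination (norm := (clear * -; grind)) p * hyc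
  have hm : (x * (x + 1)) ^ 2 = j ^ 2 + j + θ := by
    rw [hθy, hj]
    clear * -
    grind
  have k₁ : p ^ 2 * (j ^ 2 + j + θ) = φ j ^ 2 + φ j + φ θ := by
    rw [← hm, ← mul_pow, hpm, ← map_pow, hm]
    simp only [map_add, map_pow]
  have k₂ : p ^ 2 * j ^ 2 = φ θ := by rw [← mul_pow, hpj, he]
  have k₃ : p ^ 2 * θ = φ j ^ 2 := by
    have := congrArg φ k₂
    rw [map_mul, map_pow, map_pow, hθθ] at this
    rw [← this, ← mul_assoc, ← mul_pow, hp, one_pow, one_mul]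
  have k₄ : p ^ 2 * j = φ j := by linear_combination k₁ - k₂ - k₃
  have k₅ : φ e = e := by
    rw [← hpj, map_mul, ← k₄]
    linear_combination p * j * hp
  refine add_map_ne_zero hTr hθ (CharTwo.add_eq_zero.2 ?_)
  have := congrArg φ he
  rw [map_pow, k₅, hθθ] at this
  exact this.trans he.symm

end Solutions

/-! ### The power map -/

section PowerMap

variable {K : Type*} [Field K] [CharP K 2] {φ : K →+* K} {d : ℕ}

/-- If `z ^ d = 1`, then `z ^ 2` is the norm of `z` to `𝔽_q`, so `z` lies in `𝔽_q` and
`z ^ d = z ^ 2`. -/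
theorem pow_injective (hd0 : d ≠ 0) (h4 : ∀ x : K, φ (φ (φ (φ x))) = x)
    (hd : ∀ x : K, x ^ d * x = φ x * φ (φ x) * φ (φ (φ x))) :
    Function.Injective fun x : K => x ^ d := by
  have key : ∀ z : K, z ^ d = 1 → z = 1 := fun z hz => by
    have h := hd z
    have z0 : z ≠ 0 := by
      rintro rfl
      rw [zero_pow hd0] at hz
      exact zero_ne_one hz
    rw [hz, one_mul] at h
    have h2 : φ z = z := by
      refine CharTwo.sq_inj.1 ?_
      have h' := congrArg φ h
      simp only [map_mul, h4] at h'
      linear_combination φ z * h' - z * h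
    rw [h2, h2, h2] at h
    refine CharTwo.sq_inj.1 (mul_right_cancel₀ z0 ?_)
    linear_combination -h
  intro x y hxy
  have hxy : x ^ d = y ^ d := hxy
  by_cases hy : y = 0
  · rw [hy, zero_pow hd0] at hxy
    rw [hy, eq_zero_of_pow_eq_zero hxy]
  · refine (div_eq_one_iff_eq hy).1 (key _ ?_)
    rw [div_pow, hxy, div_self (pow_ne_zero d hy)]

theorem sum_pow_two_pow_telescope (n : ℕ) (y : K) :
    ∑ i ∈ Finset.range n, (y ^ 2 + y) ^ 2 ^ i = y ^ 2 ^ n + y := by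
  induction n with
  | zero => simp [CharTwo.add_self_eq_zero]
  | succ n ih =>
    rw [Finset.sum_range_succ, ih, add_pow_char_pow, ← pow_mul, ← pow_succ']
    clear * -
    grind

end PowerMap

theorem theorem1 (n q : ℕ) (hn : 1 ≤ n) (hq : q = 2 ^ n)
    (F : Type*) [Field F] [Fintype F] [DecidableEq F] (hF : Fintype.card F = q ^ 4) :
    Function.Bijective (fun x : F => x ^ (q ^ 3 + q ^ 2 + q - 1)) ∧
      ∀ c ∈ mu F (q ^ 2 + 1) \ {1}, IsAPcN c (fun x : F => x ^ (q ^ 3 + q ^ 2 + q - 1)) := by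
  have hchar : CharP F 2 := by
    have h0 : (Fintype.card F : F) = 0 := FiniteField.cast_card_eq_zero F
    rw [hF, hq] at h0
    push_cast at h0
    exact CharTwo.of_one_ne_zero_of_two_eq_zero one_ne_zero
      (eq_zero_of_pow_eq_zero (eq_zero_of_pow_eq_zero h0))
  have hφ : ∀ x : F, iterateFrobenius F 2 n x = x ^ q := fun x => by
    rw [iterateFrobenius_def, hq]
  -- Only on `𝔽_q` is this the absolute trace; on all of `F` it still satisfies `hTr`.
  let Tr : F →+ F := ∑ i ∈ Finset.range n, (iterateFrobenius F 2 i : F →+* F).toAddMonoidHom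
  have hTr : ∀ y, Tr (y ^ 2 + y) = iterateFrobenius F 2 n y + y := fun y => by
    rw [iterateFrobenius_def, ← sum_pow_two_pow_telescope]
    simp [Tr, iterateFrobenius_def]
  have h4 : ∀ x : F, iterateFrobenius F 2 n (iterateFrobenius F 2 n
      (iterateFrobenius F 2 n (iterateFrobenius F 2 n x))) = x := fun x => by
    simp only [hφ, ← pow_mul]
    rw [show q * q * q * q = q ^ 4 by ring, ← hF, FiniteField.pow_card]
  have hq2 : 2 ≤ q := by
    rw [hq]; exact Nat.le_self_pow (by omega) 2
  obtain ⟨d, hd⟩ : ∃ d, d = q ^ 3 + q ^ 2 + q - 1 := ⟨_, rfl⟩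
  have hd0 : d ≠ 0 := by omega
  have hd1 : d + 1 = q + q * q + q * q * q := by
    have : q ^ 3 + q ^ 2 + q = q + q * q + q * q * q := by ring
    omega
  rw [← hd]
  generalize iterateFrobenius F 2 n = φ at *
  have hpow : ∀ x : F, x ^ d * x = φ x * φ (φ x) * φ (φ (φ x)) := fun x => by
    rw [← pow_succ, hd1]
    simp only [hφ, ← pow_mul, pow_add]
  have hinj := pow_injective hd0 h4 hpow
  refine ⟨Finite.injective_iff_bijective.1 hinj, ?_⟩
  rintro c ⟨⟨-, hcq⟩, hc1⟩
  have hc1 : c ≠ 1 := hc1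
  have hc : c * φ (φ c) = 1 := by
    rw [hφ, hφ, ← pow_mul, ← pow_succ', ← sq, hcq]
  unfold IsAPcN cDifferentialUniformity
  refine le_antisymm (Finset.sup_le ?_) ?_
  · rintro ⟨a, b⟩ -
    by_contra! hlt
    obtain ⟨x, hx, y, hy, z, hz, hxy, hxz, hyz⟩ := Finset.two_lt_card.1 hlt
    simp only [Finset.mem_filter, Finset.mem_univ, true_and, cDerivative,
      CharTwo.sub_eq_add] at hx hy hz
    by_cases ha : a = 0
    · have h : (1 + c) * x ^ d = (1 + c) * y ^ d := by
        rw [ha, add_zero] at hx hy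
        linear_combination hx - hy
      exact hxy (hinj (mul_left_cancel₀ (add_ne_zero_of_ne (Ne.symm hc1)) h))
    · -- By homogeneity the shift can be taken to be `1`.
      have key : ∀ w : F, (w + a) ^ d + c * w ^ d = b →
          (w / a + 1) ^ d + c * (w / a) ^ d = b / a ^ d := fun w hw => by
        rw [← div_self ha, ← add_div, div_pow, div_pow, ← mul_div_assoc, ← add_div, hw]
      have hdiv : ∀ w w' : F, w / a = w' / a → w = w' := fun w w' h => by
        rwa [div_left_inj' ha] at h
      rcases three_solutions hpow h4 hc hc1 hTr hd0 (key x hx) (key y hy) (key z hz) with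
        h | h | h
      · exact hxy (hdiv _ _ h)
      · exact hxz (hdiv _ _ h)
      · exact hyz (hdiv _ _ h)
  · have hni := not_injective hpow h4 hc hc1 hTr
    simp only [Function.Injective, not_forall] at hni
    obtain ⟨x, y, hxy, hne⟩ := hni
    refine le_trans ?_ (Finset.le_sup (Finset.mem_univ ((1 : F), (x + 1) ^ d + c * x ^ d)))
    refine Finset.one_lt_card.2 ⟨x, ?_, y, ?_, hne⟩
    · simp [cDerivative, CharTwo.sub_eq_add]
    · simp [cDerivative, CharTwo.sub_eq_add, hxy]
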